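/- Let $d \ge 1$ be an integer. For $\delta > 0$, an open ball $B \subset \mathbb{R}^d$ and a real-valued Lebesgue measurable function $u$ on $B$, set $$ I_{\delta,d}(u,B) = \mathop{\int_B\int_B}_{|u(x)-u(y)|>\delta} \frac{\delta^d}{|x-y|^{2d}}\,dx\,dy \in [0,\infty], $$ and, for $u \in L^1(B)$, write $u_B = \frac{1}{|B|}\int_B u\,dx$, where $|B|$ is the Lebesgue measure of $B$. For every $\alpha > 0$ there exist constants $M_0 > 0$ and $C > 0$, depending only on $\alpha$ and $d$, such that for every $\delta > 0$, every open ball $B \subset \mathbb{R}^d$ and every real-valued measurable function $u$ on $B$ with $\delta^{-d} I_{\delta,d}(u,B) \le M_0$, one has $u \in L^1(B)$ and $$ \frac{1}{|B|}\int_B e^{\alpha \delta^{-1} |u-u_B|}\,dx \le C. $$ -/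

import Mathlib

open MeasureTheory
open scoped ENNReal

/-- The nonlocal functional
`I_{δ,p}(u, O) = ∬_{x, y ∈ O, |u(x) - u(y)| > δ} δ ^ p / |x - y| ^ (d + p) dy dx`
on a subset `O` of `ℝᵈ` (Euclidean norm, Lebesgue measure), with values in `[0, ∞]`.
The diagonal plays no role when `δ ≥ 0`, since the condition `|u(x) - u(y)| > δ` excludes it. -/
noncomputable def nonlocalEnergy {d : ℕ} (δ p : ℝ) (u : EuclideanSpace ℝ (Fin d) → ℝ)
    (O : Set (EuclideanSpace ℝ (Fin d))) : ℝ≥0∞ :=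
  ∫⁻ x in O, ∫⁻ y in {y ∈ O | δ < |u x - u y|},
    ENNReal.ofReal (δ ^ p / ‖x - y‖ ^ ((d : ℝ) + p))

/-! The proof is a level-set iteration in the spirit of John–Nirenberg. Let `S` be the part of the
ball where `u > m`, with `|S|` at most half of `|B|`. A point of `S` sees a portion of `B \ S` of
measure at least `|S|` within distance comparable to `|S|^(1/d)`, so the kernel `|x - y|^(-2d)`
integrates over `B \ S` to at least `c / |S|` (`le_lintegral_ball_diff`). Where `u > m + δ`, all of
this interaction counts in the energy, since `u ≤ m` on `B \ S`. Hence `|{u > m + δ}| ≤ C M₀ |{u >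
m}|` (`volume_superlevel_add_le`). Starting from an approximate median and iterating for `u` and
`-u`, the tails at height `k δ` decay like `(C M₀)^k`. Choosing `C M₀ = exp (-α) / 2` beats the
growth of `exp (α k)`. Exponential integrability around the median bounds its distance to the mean,
so the median can be replaced by the mean. -/

open Metric in
/-- Inside a ball of radius `r`, a ball of radius `2 * s` centred at a point of the first one
leaves room for a ball of radius `s`. -/
lemma exists_ball_subset_inter_ball {E : Type*} [NormedAddCommGroup E] [NormedSpace ℝ E]
    {x z : E} {r s : ℝ} (hr : 0 < r) (hs : 0 < s) (hsr : s ≤ r) (hx : x ∈ ball z r) :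
    ∃ w, ball w s ⊆ ball x (2 * s) ∩ ball z r := by
  have hxz : ‖z - x‖ < r := by rwa [mem_ball, dist_comm, dist_eq_norm] at hx
  have ht : 0 < s / r := div_pos hs hr
  have ht1 : s / r ≤ 1 := (div_le_one hr).2 hsr
  have hst : s / r * r = s := div_mul_cancel₀ s hr.ne'
  -- Moving from `x` towards `z` by the fraction `s / r` costs at most `s` in distance to `x` and
  -- leaves at most `(1 - s / r) * r = r - s` to `z`.
  refine ⟨x + (s / r) • (z - x), fun y hy => ?_⟩
  rw [mem_ball] at hy
  constructor
  · have h1 : dist (x + (s / r) • (z - x)) x ≤ s := by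
      rw [dist_eq_norm, add_sub_cancel_left, norm_smul, Real.norm_of_nonneg ht.le]
      nlinarith
    have := dist_triangle y (x + (s / r) • (z - x)) x
    rw [mem_ball]; linarith
  · have h1 : dist (x + (s / r) • (z - x)) z ≤ r - s := by
      have : x + (s / r) • (z - x) - z = -((1 - s / r) • (z - x)) := by module
      rw [dist_eq_norm, this, norm_neg, norm_smul, Real.norm_of_nonneg (by linarith)]
      nlinarith
    have := dist_triangle y (x + (s / r) • (z - x)) z
    rw [mem_ball]; linarith

/-- The volume of the Euclidean unit ball. -/
noncomputable def unitBallVolume (d : ℕ) : ℝ :=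
  volume.real (Metric.ball (0 : EuclideanSpace ℝ (Fin d)) 1)

lemma unitBallVolume_pos (d : ℕ) : 0 < unitBallVolume d :=
  ENNReal.toReal_pos (Metric.measure_ball_pos volume _ one_pos).ne' measure_ball_lt_top.ne

lemma volume_ball_eq_unitBallVolume {d : ℕ} (x : EuclideanSpace ℝ (Fin d)) {r : ℝ} (hr : 0 < r) :
    volume (Metric.ball x r) = ENNReal.ofReal (r ^ d * unitBallVolume d) := by
  rw [Measure.addHaar_ball_of_pos _ _ hr, finrank_euclideanSpace_fin,
    ENNReal.ofReal_mul (by positivity), unitBallVolume, Measure.real,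
    ENNReal.ofReal_toReal measure_ball_lt_top.ne]

/-- The interaction of a point of `S` with the complement of `S` in a ball is at least a constant
multiple of `1 / |S|`. -/
lemma le_lintegral_ball_diff {d : ℕ} (hd : 1 ≤ d) {z : EuclideanSpace ℝ (Fin d)} {r a : ℝ}
    (hr : 0 < r) (ha : 0 < a) {S : Set (EuclideanSpace ℝ (Fin d))} (hS : MeasurableSet S)
    (hSa : volume S = ENNReal.ofReal a) (hhalf : 2 * volume S ≤ volume (Metric.ball z r))
    {x : EuclideanSpace ℝ (Fin d)} (hxS : x ∈ S) (hx : x ∈ Metric.ball z r) :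
    ENNReal.ofReal (unitBallVolume d ^ 2 / (4 ^ (d + 1) * a)) ≤
      ∫⁻ y in Metric.ball z r \ S, ENNReal.ofReal (1 / ‖x - y‖ ^ ((d : ℝ) + d)) := by
  have hω := unitBallVolume_pos d
  have hd0 : d ≠ 0 := by omega
  -- A ball of radius `s` has volume `2 * a`, twice that of `S`, so at least `a` of it lies outside
  -- `S`. The half-volume hypothesis then says `s ≤ r`.
  obtain ⟨s, hs, hsd⟩ : ∃ s : ℝ, 0 < s ∧ s ^ d = 2 * a / unitBallVolume d :=
    ⟨(2 * a / unitBallVolume d) ^ (d : ℝ)⁻¹, by positivity,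
      Real.rpow_inv_natCast_pow (by positivity) hd0⟩
  have hsω : s ^ d * unitBallVolume d = 2 * a := by rw [hsd]; field_simp
  have hsr : s ≤ r := by
    rw [← pow_le_pow_iff_left₀ hs.le hr.le hd0]
    rw [volume_ball_eq_unitBallVolume z hr, hSa, ← ENNReal.ofReal_ofNat,
      ← ENNReal.ofReal_mul (by norm_num), ENNReal.ofReal_le_ofReal_iff (by positivity),
      ← hsω] at hhalf
    exact le_of_mul_le_mul_right hhalf hω
  obtain ⟨w, hw⟩ := exists_ball_subset_inter_ball hr hs hsr hx
  have hvol : ENNReal.ofReal a ≤ volume (Metric.ball w s \ S) := by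
    have h1 := le_measure_sdiff (μ := volume) (s₁ := Metric.ball w s) (s₂ := S)
    rw [volume_ball_eq_unitBallVolume w hs, hsω, hSa, ← ENNReal.ofReal_sub _ ha.le] at h1
    simpa [two_mul] using h1
  have hconst : unitBallVolume d ^ 2 / (4 ^ (d + 1) * a) = 1 / (2 * s) ^ (d + d) * a := by
    have : (2 * s) ^ (d + d) = 4 ^ d * (s ^ d) ^ 2 := by
      rw [mul_pow, ← two_mul, pow_mul, pow_mul, ← pow_mul s 2, mul_comm 2 d, pow_mul s]; norm_num
    rw [this, hsd]; field_simp; ring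
  calc ENNReal.ofReal (unitBallVolume d ^ 2 / (4 ^ (d + 1) * a))
      = ENNReal.ofReal (1 / (2 * s) ^ (d + d)) * ENNReal.ofReal a := by
        rw [hconst, ENNReal.ofReal_mul (by positivity)]
    _ ≤ ENNReal.ofReal (1 / (2 * s) ^ (d + d)) * volume (Metric.ball w s \ S) := by gcongr
    _ = ∫⁻ _ in Metric.ball w s \ S, ENNReal.ofReal (1 / (2 * s) ^ (d + d)) := by
        rw [setLIntegral_const]
    _ ≤ ∫⁻ y in Metric.ball w s \ S, ENNReal.ofReal (1 / ‖x - y‖ ^ ((d : ℝ) + d)) := by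
        refine setLIntegral_mono' (measurableSet_ball.diff hS) fun y hy => ?_
        have hxy : 0 < ‖x - y‖ := norm_pos_iff.2 (sub_ne_zero.2 fun h => hy.2 (h ▸ hxS))
        have hlt : ‖x - y‖ < 2 * s := by
          have := (hw hy.1).1
          rwa [Metric.mem_ball, dist_comm, dist_eq_norm] at this
        rw [← Nat.cast_add, Real.rpow_natCast]
        gcongr
    _ ≤ _ := lintegral_mono_set (Set.sdiff_subset_sdiff_left fun y hy => (hw hy).2)

/-! ### Decay of superlevel sets -/

/-- The superlevel set at height `m + δ` is small compared with the one at height `m`,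
as soon as the energy is small and the latter occupies at most half of the ball. -/
lemma volume_superlevel_add_le {d : ℕ} (hd : 1 ≤ d) {δ M m : ℝ} (hδ : 0 < δ) (hM : 0 ≤ M)
    {z : EuclideanSpace ℝ (Fin d)} {r : ℝ} (hr : 0 < r)
    {v : EuclideanSpace ℝ (Fin d) → ℝ} (hv : Measurable v)
    (hE : ENNReal.ofReal (δ ^ (-(d : ℝ))) * nonlocalEnergy δ (d : ℝ) v (Metric.ball z r)
      ≤ ENNReal.ofReal M)
    (hhalf : 2 * volume (Metric.ball z r ∩ {x | m < v x}) ≤ volume (Metric.ball z r)) :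
    volume (Metric.ball z r ∩ {x | m + δ < v x}) ≤
      ENNReal.ofReal (4 ^ (d + 1) / unitBallVolume d ^ 2 * M) *
        volume (Metric.ball z r ∩ {x | m < v x}) := by
  have hω := unitBallVolume_pos d
  set S := Metric.ball z r ∩ {x | m < v x} with hSdef
  set T := Metric.ball z r ∩ {x | m + δ < v x} with hTdef
  have hSm : MeasurableSet S := measurableSet_ball.inter (measurableSet_lt measurable_const hv)
  have hTm : MeasurableSet T := measurableSet_ball.inter (measurableSet_lt measurable_const hv)
  have hTS : T ⊆ S := fun x hx => ⟨hx.1, by have := hx.2; simp only [Set.mem_ofPred_eq] at *; linarith⟩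
  have hSfin : volume S ≠ ∞ := (measure_lt_top_of_subset Set.inter_subset_left
    measure_ball_lt_top.ne).ne
  rcases eq_or_ne (volume S) 0 with h0 | h0
  · rw [measure_mono_null hTS h0]; exact zero_le
  have ha : 0 < volume.real S := ENNReal.toReal_pos h0 hSfin
  have hSa : volume S = ENNReal.ofReal (volume.real S) := (ENNReal.ofReal_toReal hSfin).symm
  set a := volume.real S
  set c := unitBallVolume d ^ 2 / (4 ^ (d + 1) * a) with hc
  have hc0 : 0 < c := by positivity
  have hpow : δ ^ (-(d : ℝ)) * δ ^ (d : ℝ) = 1 := by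
    rw [← Real.rpow_add hδ]; simp
  -- Restrict the energy to `x ∈ T` and `y` in the ball outside `S`: there `v x > m + δ` and `v y ≤
  -- m`, so every such pair counts.
  have hlow : ENNReal.ofReal (δ ^ (d : ℝ)) * (ENNReal.ofReal c * volume T) ≤
      nonlocalEnergy δ (d : ℝ) v (Metric.ball z r) := by
    calc ENNReal.ofReal (δ ^ (d : ℝ)) * (ENNReal.ofReal c * volume T)
        = ∫⁻ _ in T, ENNReal.ofReal (δ ^ (d : ℝ)) * ENNReal.ofReal c := by
          rw [setLIntegral_const, mul_assoc]
      _ ≤ ∫⁻ x in T, ∫⁻ y in {y ∈ Metric.ball z r | δ < |v x - v y|},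
            ENNReal.ofReal (δ ^ (d : ℝ) / ‖x - y‖ ^ ((d : ℝ) + d)) := by
          refine setLIntegral_mono' hTm fun x hx => ?_
          calc ENNReal.ofReal (δ ^ (d : ℝ)) * ENNReal.ofReal c
              ≤ ENNReal.ofReal (δ ^ (d : ℝ)) *
                ∫⁻ y in Metric.ball z r \ S, ENNReal.ofReal (1 / ‖x - y‖ ^ ((d : ℝ) + d)) := by
                gcongr
                exact le_lintegral_ball_diff hd hr ha hSm hSa hhalf (hTS hx) hx.1
            _ = ∫⁻ y in Metric.ball z r \ S,
                  ENNReal.ofReal (δ ^ (d : ℝ) / ‖x - y‖ ^ ((d : ℝ) + d)) := by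
                rw [← lintegral_const_mul' _ _ ENNReal.ofReal_ne_top]
                refine lintegral_congr fun y => ?_
                rw [← ENNReal.ofReal_mul (by positivity), mul_one_div]
            _ ≤ _ := by
                refine lintegral_mono_set fun y hy => ⟨hy.1, ?_⟩
                have h1 : m + δ < v x := hx.2
                have h2 : v y ≤ m := not_lt.1 fun h => hy.2 ⟨hy.1, h⟩
                exact lt_of_lt_of_le (by linarith) (le_abs_self _)
      _ ≤ _ := lintegral_mono_set Set.inter_subset_left
  have hT : ENNReal.ofReal c * volume T ≤ ENNReal.ofReal M := by
    refine le_trans (le_trans (le_of_eq ?_) (mul_le_mul_right hlow _)) hE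
    rw [← mul_assoc (ENNReal.ofReal (δ ^ (-(d : ℝ)))), ← ENNReal.ofReal_mul (by positivity), hpow,
      ENNReal.ofReal_one, one_mul]
  -- As `c` is inversely proportional to `|S|`, dividing by it produces the factor `|S|` that makes
  -- the estimate iterable.
  calc volume T = ENNReal.ofReal c⁻¹ * (ENNReal.ofReal c * volume T) := by
        rw [← mul_assoc, ← ENNReal.ofReal_mul (by positivity), inv_mul_cancel₀ hc0.ne',
          ENNReal.ofReal_one, one_mul]
    _ ≤ ENNReal.ofReal c⁻¹ * ENNReal.ofReal M := by gcongr
    _ = _ := by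
        rw [hSa, ← ENNReal.ofReal_mul (by positivity), ← ENNReal.ofReal_mul (by positivity), hc]
        congr 1; field_simp

/-- Geometric decay of the superlevel sets. -/
lemma volume_superlevel_add_nat_mul_le {d : ℕ} (hd : 1 ≤ d) {δ M m : ℝ} (hδ : 0 < δ) (hM : 0 ≤ M)
    {z : EuclideanSpace ℝ (Fin d)} {r : ℝ} (hr : 0 < r)
    {v : EuclideanSpace ℝ (Fin d) → ℝ} (hv : Measurable v)
    (hE : ENNReal.ofReal (δ ^ (-(d : ℝ))) * nonlocalEnergy δ (d : ℝ) v (Metric.ball z r)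
      ≤ ENNReal.ofReal M)
    (hhalf : 2 * volume (Metric.ball z r ∩ {x | m < v x}) ≤ volume (Metric.ball z r)) (k : ℕ) :
    2 * volume (Metric.ball z r ∩ {x | m + k * δ < v x}) ≤
      ENNReal.ofReal ((4 ^ (d + 1) / unitBallVolume d ^ 2 * M) ^ k) * volume (Metric.ball z r) := by
  have hω := unitBallVolume_pos d
  have hε : 0 ≤ 4 ^ (d + 1) / unitBallVolume d ^ 2 * M := by positivity
  induction k with
  | zero => simpa using hhalf
  | succ k ih =>
    -- Superlevel sets shrink as the height grows, so the half-volume condition persists.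
    have hk : 2 * volume (Metric.ball z r ∩ {x | m + k * δ < v x}) ≤ volume (Metric.ball z r) := by
      refine le_trans ?_ hhalf
      gcongr with x
      exact le_add_of_nonneg_right (by positivity)
    have hstep := volume_superlevel_add_le hd hδ hM hr hv hE hk
    rw [show m + ((k + 1 : ℕ) : ℝ) * δ = m + k * δ + δ by push_cast; ring]
    calc _ ≤ 2 * (ENNReal.ofReal (4 ^ (d + 1) / unitBallVolume d ^ 2 * M) *
              volume (Metric.ball z r ∩ {x | m + k * δ < v x})) := by gcongr
      _ = ENNReal.ofReal (4 ^ (d + 1) / unitBallVolume d ^ 2 * M) *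
              (2 * volume (Metric.ball z r ∩ {x | m + k * δ < v x})) := by ring
      _ ≤ ENNReal.ofReal (4 ^ (d + 1) / unitBallVolume d ^ 2 * M) *
              (ENNReal.ofReal ((4 ^ (d + 1) / unitBallVolume d ^ 2 * M) ^ k) *
                volume (Metric.ball z r)) := by gcongr
      _ = _ := by rw [← mul_assoc, ← ENNReal.ofReal_mul hε, pow_succ' (_ * M)]

/-! ### Approximate medians and exponential integrability -/

/-- Every real-valued measurable function on a finite measure space has a median, up to one grid
step. -/
lemma exists_int_approx_median {Ω : Type*} [MeasurableSpace Ω] (μ : Measure Ω) [IsFiniteMeasure μ]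
    {f : Ω → ℝ} (hf : Measurable f) {δ : ℝ} (hδ : 0 < δ) :
    ∃ n : ℤ, 2 * μ {x | n * δ < f x} ≤ μ Set.univ ∧
      2 * μ {x | f x < (n - 1) * δ} ≤ μ Set.univ := by
  rcases eq_or_ne (μ Set.univ) 0 with h0 | h0
  · refine ⟨0, ?_, ?_⟩ <;> simp [Measure.measure_univ_eq_zero.1 h0]
  have hsmall : ∀ s : ℕ → Set Ω, (∀ n, MeasurableSet (s n)) → Antitone s → (⋂ n, s n) = ∅ →
      ∃ n, 2 * μ (s n) < μ Set.univ := by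
    intro s hs hanti hinter
    have ht := tendsto_measure_iInter_atTop (μ := μ) (fun n => (hs n).nullMeasurableSet) hanti
      ⟨0, measure_ne_top _ _⟩
    rw [hinter, measure_empty] at ht
    have ht2 := ENNReal.Tendsto.const_mul (a := 2) ht (Or.inr (by simp))
    rw [mul_zero] at ht2
    exact (ht2.eventually_lt_const (pos_iff_ne_zero.2 h0)).exists
  obtain ⟨N, hN⟩ := hsmall (fun n => {x | n * δ < f x})
    (fun n => measurableSet_lt measurable_const hf)
    (fun a b hab x hx => by
      have h1 : (b : ℝ) * δ < f x := hx
      have h2 : (a : ℝ) * δ ≤ b * δ := by gcongr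
      exact lt_of_le_of_lt h2 h1)
    (by
      refine Set.eq_empty_of_forall_notMem fun x hx => ?_
      obtain ⟨n, hn⟩ := exists_nat_ge (f x / δ)
      exact absurd (Set.mem_iInter.1 hx n) (not_lt.2 ((div_le_iff₀ hδ).1 hn)))
  obtain ⟨N', hN'⟩ := hsmall (fun n => {x | f x ≤ -(n * δ)})
    (fun n => measurableSet_le hf measurable_const)
    (fun a b hab x hx => by
      have h1 : f x ≤ -((b : ℝ) * δ) := hx
      have h2 : (a : ℝ) * δ ≤ b * δ := by gcongr
      exact le_trans h1 (neg_le_neg h2))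
    (by
      refine Set.eq_empty_of_forall_notMem fun x hx => ?_
      obtain ⟨n, hn⟩ := exists_nat_gt (-f x / δ)
      have h1 : f x ≤ -(n * δ) := Set.mem_iInter.1 hx n
      have h2 := (div_lt_iff₀ hδ).1 hn
      linarith)
  have hcompl : ∀ t, μ Set.univ = μ {x | t < f x} + μ {x | f x ≤ t} := by
    intro t
    rw [← measure_add_measure_compl (measurableSet_lt measurable_const hf : MeasurableSet {x | t < f x})]
    congr 2; ext x; simp
  -- Take the least grid level above which at most half of the mass lies. It exists because the
  -- condition holds at `N` and fails below `-N'`; minimality at `n - 1` gives the lower bound.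
  obtain ⟨n, hn, hmin⟩ := Int.exists_least_of_bdd
    (P := fun n : ℤ => 2 * μ {x | n * δ < f x} ≤ μ Set.univ)
    ⟨-N', fun n hn => by
      by_contra! hlt
      have hle : μ {x | -((N' : ℝ) * δ) < f x} ≤ μ {x | n * δ < f x} := by
        refine measure_mono fun x hx => ?_
        have h1 : -((N' : ℝ) * δ) < f x := hx
        have h2 : (n : ℝ) ≤ -(N' : ℝ) := by exact_mod_cast hlt.le
        have h3 := mul_le_mul_of_nonneg_right h2 hδ.le
        simp only [Set.mem_ofPred_eq]; linarith
      have h := hcompl (-((N' : ℝ) * δ))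
      have hcontra : 2 * μ Set.univ < 2 * μ Set.univ := by
        calc 2 * μ Set.univ = 2 * μ {x | -((N' : ℝ) * δ) < f x} +
              2 * μ {x | f x ≤ -((N' : ℝ) * δ)} := by rw [h, mul_add]
          _ < μ Set.univ + μ Set.univ :=
              ENNReal.add_lt_add_of_le_of_lt
                (ENNReal.mul_ne_top (by simp) (measure_ne_top _ _))
                (le_trans (by gcongr) hn) hN'
          _ = 2 * μ Set.univ := (two_mul _).symm
      exact lt_irrefl _ hcontra⟩
    ⟨N, by simpa using hN.le⟩
  refine ⟨n, hn, ?_⟩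
  have hlt : ¬ 2 * μ {x | ((n - 1 : ℤ) : ℝ) * δ < f x} ≤ μ Set.univ := fun h => by
    have := hmin _ h; omega
  push_cast at hlt
  by_contra! hgt
  have hle : μ {x | f x < ((n : ℝ) - 1) * δ} ≤ μ {x | f x ≤ ((n : ℝ) - 1) * δ} :=
    measure_mono fun x (hx : f x < _) => hx.le
  have hcontra : 2 * μ Set.univ < 2 * μ Set.univ := by
    calc 2 * μ Set.univ = μ Set.univ + μ Set.univ := two_mul _
      _ < 2 * μ {x | ((n : ℝ) - 1) * δ < f x} + 2 * μ {x | f x ≤ ((n : ℝ) - 1) * δ} :=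
          ENNReal.add_lt_add (not_le.1 hlt) (lt_of_lt_of_le hgt (by gcongr))
      _ = 2 * μ Set.univ := by rw [hcompl (((n : ℝ) - 1) * δ), mul_add]
  exact lt_irrefl _ hcontra

/-- Exponential integrability from geometric decay of the tails. -/
lemma lintegral_exp_le_of_geometric_tail {Ω : Type*} [MeasurableSpace Ω] (μ : Measure Ω)
    {f : Ω → ℝ} (hf : Measurable f) {α : ℝ} (hα : 0 < α)
    (htail : ∀ k : ℕ, μ {x | (k : ℝ) + 1 < f x} ≤
      ENNReal.ofReal ((Real.exp (-α) / 2) ^ k) * μ Set.univ) :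
    ∫⁻ x, ENNReal.ofReal (Real.exp (α * f x)) ∂μ ≤
      ENNReal.ofReal (Real.exp α + 2 * Real.exp (2 * α)) * μ Set.univ := by
  have hmeas : ∀ k : ℕ, MeasurableSet {x | (k : ℝ) + 1 < f x} := fun k =>
    measurableSet_lt measurable_const hf
  -- On `k + 1 < f x ≤ k + 2` the `k`-th term alone dominates; on `f x ≤ 1` the constant `exp α`
  -- does.
  have hpt : ∀ x, ENNReal.ofReal (Real.exp (α * f x)) ≤ ENNReal.ofReal (Real.exp α) +
      ∑' k : ℕ, {x | (k : ℝ) + 1 < f x}.indicator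
        (fun _ => ENNReal.ofReal (Real.exp (α * (k + 2)))) x := by
    intro x
    by_cases hx : f x ≤ 1
    · refine le_trans (ENNReal.ofReal_le_ofReal (Real.exp_le_exp.2 ?_)) le_self_add
      nlinarith
    · push Not at hx
      have hceil : 2 ≤ ⌈f x⌉₊ := Nat.lt_ceil.2 (by exact_mod_cast hx)
      obtain ⟨k, hk⟩ := Nat.exists_eq_add_of_le' hceil
      have h1 : f x ≤ k + 2 := by have := Nat.le_ceil (f x); rw [hk] at this; exact_mod_cast this
      have h2 : (k : ℝ) + 1 < f x := by
        have : k + 1 < ⌈f x⌉₊ := by omega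
        exact_mod_cast Nat.lt_ceil.1 this
      refine le_trans ?_ (le_trans (ENNReal.le_tsum k) le_add_self)
      rw [Set.indicator_of_mem (show x ∈ {x | (k : ℝ) + 1 < f x} from h2)]
      gcongr
  -- The terms equal `exp (2 * α) * (1 / 2) ^ k`.
  have hgeo : HasSum (fun k : ℕ => Real.exp (α * (k + 2)) * (Real.exp (-α) / 2) ^ k)
      (2 * Real.exp (2 * α)) := by
    rw [mul_comm]
    refine (hasSum_geometric_two.mul_left (Real.exp (2 * α))).congr_fun fun k => ?_
    rw [show α * ((k : ℝ) + 2) = k * α + 2 * α by ring, Real.exp_add, Real.exp_nat_mul, Real.exp_neg,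
      div_pow, inv_pow, div_pow, one_pow]
    field_simp
  calc ∫⁻ x, ENNReal.ofReal (Real.exp (α * f x)) ∂μ
      ≤ ∫⁻ x, (ENNReal.ofReal (Real.exp α) + ∑' k : ℕ, {x | (k : ℝ) + 1 < f x}.indicator
        (fun _ => ENNReal.ofReal (Real.exp (α * (k + 2)))) x) ∂μ := lintegral_mono hpt
    _ = ENNReal.ofReal (Real.exp α) * μ Set.univ +
        ∑' k : ℕ, ENNReal.ofReal (Real.exp (α * (k + 2))) * μ {x | (k : ℝ) + 1 < f x} := by
        rw [lintegral_add_left measurable_const, lintegral_const, lintegral_tsum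
          fun k => (measurable_const.indicator (hmeas k)).aemeasurable]
        congr 2; ext k
        rw [lintegral_indicator_const (hmeas k)]
    _ ≤ ENNReal.ofReal (Real.exp α) * μ Set.univ +
        ∑' k : ℕ, ENNReal.ofReal (Real.exp (α * (k + 2)) * (Real.exp (-α) / 2) ^ k) *
          μ Set.univ := by
        refine add_le_add_right (ENNReal.tsum_le_tsum fun k => ?_) _
        rw [ENNReal.ofReal_mul (by positivity), mul_assoc]
        exact mul_le_mul_right (htail k) _
    _ = _ := by
        rw [ENNReal.tsum_mul_right, ← ENNReal.ofReal_tsum_of_nonneg (fun k => by positivity)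
          hgeo.summable, hgeo.tsum_eq, ← add_mul, ← ENNReal.ofReal_add (by positivity)
          (by positivity)]

/-- Exponential integrability around some constant gives exponential integrability around the
mean. -/
lemma integrable_and_laverage_exp_le {Ω : Type*} [MeasurableSpace Ω] (μ : Measure Ω)
    [IsFiniteMeasure μ] [NeZero μ] {f : Ω → ℝ} (hf : AEMeasurable f μ) {β D m : ℝ} (hβ : 0 < β)
    (hD : 0 ≤ D)
    (h : ∫⁻ x, ENNReal.ofReal (Real.exp (β * |f x - m|)) ∂μ ≤ ENNReal.ofReal D * μ Set.univ) :
    Integrable f μ ∧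
      (⨍⁻ x, ENNReal.ofReal (Real.exp (β * |f x - ⨍ y, f y ∂μ|)) ∂μ) ≤
        ENNReal.ofReal (Real.exp D * D) := by
  have hexpm : AEMeasurable (fun x => Real.exp (β * |f x - m|)) μ := by fun_prop
  have hexp : Integrable (fun x => Real.exp (β * |f x - m|)) μ := by
    refine ⟨hexpm.aestronglyMeasurable, ?_⟩
    rw [hasFiniteIntegral_iff_ofReal (Filter.Eventually.of_forall fun x => (Real.exp_pos _).le)]
    exact lt_of_le_of_lt h (ENNReal.mul_lt_top ENNReal.ofReal_lt_top (measure_lt_top _ _))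
  have hle : ∀ t : ℝ, t ≤ Real.exp t := fun t => by linarith [Real.add_one_le_exp t]
  have hsub : Integrable (fun x => f x - m) μ := by
    refine Integrable.mono' (hexp.const_mul β⁻¹) (hf.sub_const m).aestronglyMeasurable
      (Filter.Eventually.of_forall fun x => ?_)
    rw [Real.norm_eq_abs, inv_mul_eq_div, le_div_iff₀ hβ, mul_comm]
    exact hle _
  have hint : Integrable f μ := by
    simpa [Pi.add_def] using hsub.add (integrable_const m)
  refine ⟨hint, ?_⟩
  have hμ0 : μ Set.univ ≠ 0 := NeZero.ne _
  have hμ : 0 < μ.real Set.univ := ENNReal.toReal_pos hμ0 (measure_ne_top _ _)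
  have hint_exp : ∫ x, Real.exp (β * |f x - m|) ∂μ ≤ D * μ.real Set.univ := by
    rw [integral_eq_lintegral_of_nonneg_ae
      (Filter.Eventually.of_forall fun x => (Real.exp_pos _).le) hexp.1]
    refine le_trans (ENNReal.toReal_mono
      (ENNReal.mul_ne_top ENNReal.ofReal_ne_top (measure_ne_top _ _)) h) ?_
    rw [ENNReal.toReal_mul, ENNReal.toReal_ofReal hD, Measure.real]
  -- By `t ≤ exp t`, `β * |mean - m|` is at most the average of `exp (β * |f - m|)`, hence at most
  -- `D`; recentring at the mean therefore costs a factor `exp D`.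
  have hmean : β * |m - ⨍ y, f y ∂μ| ≤ D := by
    have h1 : (⨍ y, f y ∂μ) - m = (μ.real Set.univ)⁻¹ * ∫ x, (f x - m) ∂μ := by
      rw [average_eq, integral_sub hint (integrable_const m), integral_const, smul_eq_mul,
        smul_eq_mul]
      field_simp
    rw [abs_sub_comm, h1, abs_mul, abs_of_pos (inv_pos.2 hμ)]
    have h2 : β * |∫ x, (f x - m) ∂μ| ≤ D * μ.real Set.univ := by
      refine le_trans (mul_le_mul_of_nonneg_left abs_integral_le_integral_abs hβ.le) ?_
      rw [← integral_const_mul]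
      exact le_trans (integral_mono (hsub.abs.const_mul β) hexp fun x => hle _) hint_exp
    rw [mul_left_comm, inv_mul_eq_div, div_le_iff₀ hμ]
    exact h2
  have hpt : ∀ x, ENNReal.ofReal (Real.exp (β * |f x - ⨍ y, f y ∂μ|)) ≤
      ENNReal.ofReal (Real.exp D) * ENNReal.ofReal (Real.exp (β * |f x - m|)) := fun x => by
    rw [← ENNReal.ofReal_mul (Real.exp_pos _).le, ← Real.exp_add]
    refine ENNReal.ofReal_le_ofReal (Real.exp_le_exp.2 ?_)
    have := mul_le_mul_of_nonneg_left (abs_sub_le (f x) m (⨍ y, f y ∂μ)) hβ.le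
    linarith
  rw [laverage_eq, ENNReal.div_le_iff hμ0 (measure_ne_top _ _)]
  calc _ ≤ ∫⁻ x, ENNReal.ofReal (Real.exp D) * ENNReal.ofReal (Real.exp (β * |f x - m|)) ∂μ :=
        lintegral_mono hpt
    _ = ENNReal.ofReal (Real.exp D) * ∫⁻ x, ENNReal.ofReal (Real.exp (β * |f x - m|)) ∂μ :=
        lintegral_const_mul' _ _ ENNReal.ofReal_ne_top
    _ ≤ ENNReal.ofReal (Real.exp D) * (ENNReal.ofReal D * μ Set.univ) := by gcongr
    _ = _ := by rw [← mul_assoc, ← ENNReal.ofReal_mul (Real.exp_pos _).le]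

/-! ### Invariance of the energy and conclusion -/

/-- Allows an a.e. measurable function to be replaced by a measurable representative. The inner
domain of integration also depends on the function, but changes only by a null set. -/
lemma nonlocalEnergy_congr_ae {d : ℕ} (δ p : ℝ) {u v : EuclideanSpace ℝ (Fin d) → ℝ}
    {O : Set (EuclideanSpace ℝ (Fin d))} (hO : MeasurableSet O)
    (huv : u =ᵐ[volume.restrict O] v) : nonlocalEnergy δ p u O = nonlocalEnergy δ p v O := by
  unfold nonlocalEnergy
  refine lintegral_congr_ae (huv.mono fun x hx => ?_)
  refine setLIntegral_congr ?_
  rw [Filter.EventuallyEq, ae_restrict_iff' hO] at huv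
  filter_upwards [huv] with y hy
  refine propext (and_congr_right fun hyO => ?_)
  rw [hx, hy hyO]

/-- Turns decay of superlevel sets into decay of sublevel sets. -/
lemma nonlocalEnergy_neg {d : ℕ} (δ p : ℝ) (u : EuclideanSpace ℝ (Fin d) → ℝ)
    (O : Set (EuclideanSpace ℝ (Fin d))) :
    nonlocalEnergy δ p (fun x => -u x) O = nonlocalEnergy δ p u O := by
  unfold nonlocalEnergy
  refine lintegral_congr fun x => ?_
  have : ∀ y, |-u x - -u y| = |u x - u y| := fun y => by rw [neg_sub_neg, abs_sub_comm]
  simp only [this]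

/-- Exponential integrability of a function of small energy around an approximate median. -/
lemma exists_lintegral_exp_le_of_nonlocalEnergy_le {d : ℕ} (hd : 1 ≤ d) {α δ : ℝ} (hα : 0 < α)
    (hδ : 0 < δ) {z : EuclideanSpace ℝ (Fin d)} {r : ℝ} (hr : 0 < r)
    {v : EuclideanSpace ℝ (Fin d) → ℝ} (hv : Measurable v)
    (hE : ENNReal.ofReal (δ ^ (-(d : ℝ))) * nonlocalEnergy δ (d : ℝ) v (Metric.ball z r)
      ≤ ENNReal.ofReal (unitBallVolume d ^ 2 / 4 ^ (d + 1) * (Real.exp (-α) / 2))) :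
    ∃ m : ℝ, ∫⁻ x in Metric.ball z r, ENNReal.ofReal (Real.exp (α * δ⁻¹ * |v x - m|)) ≤
      ENNReal.ofReal (Real.exp α + 2 * Real.exp (2 * α)) * volume (Metric.ball z r) := by
  have hω := unitBallVolume_pos d
  -- Chosen so that the decay ratio per step `δ` is exactly `exp (-α) / 2`.
  set M := unitBallVolume d ^ 2 / 4 ^ (d + 1) * (Real.exp (-α) / 2) with hMdef
  have hM : 0 ≤ M := by positivity
  have hε : 4 ^ (d + 1) / unitBallVolume d ^ 2 * M = Real.exp (-α) / 2 := by
    rw [hMdef]; field_simp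
  have : IsFiniteMeasure (volume.restrict (Metric.ball z r)) := ⟨by simp [measure_ball_lt_top]⟩
  have hres : ∀ s : Set (EuclideanSpace ℝ (Fin d)), MeasurableSet s →
      volume.restrict (Metric.ball z r) s = volume (Metric.ball z r ∩ s) := fun s hs => by
    rw [Measure.restrict_apply hs, Set.inter_comm]
  obtain ⟨n, hup, hlow⟩ := exists_int_approx_median (volume.restrict (Metric.ball z r)) hv hδ
  rw [hres _ (measurableSet_lt measurable_const hv), Measure.restrict_apply_univ] at hup
  rw [hres _ (measurableSet_lt hv measurable_const), Measure.restrict_apply_univ] at hlow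
  have hlow' : 2 * volume (Metric.ball z r ∩ {x | -((n - 1) * δ) < -v x}) ≤
      volume (Metric.ball z r) := by simpa only [neg_lt_neg_iff] using hlow
  have hup_k := volume_superlevel_add_nat_mul_le hd hδ hM hr hv hE hup
  have hlow_k := volume_superlevel_add_nat_mul_le hd hδ hM hr hv.neg
    (by rwa [← nonlocalEnergy_neg] at hE) hlow'
  rw [hε] at hup_k hlow_k
  refine ⟨n * δ, ?_⟩
  have hfm : Measurable fun x => δ⁻¹ * |v x - n * δ| := by fun_prop
  have key := lintegral_exp_le_of_geometric_tail (volume.restrict (Metric.ball z r)) hfm hα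
    fun k => by
      rw [hres _ (measurableSet_lt measurable_const hfm), Measure.restrict_apply_univ]
      -- The extra unit in `k + 1` absorbs the grid step between the levels `n * δ` and `(n - 1) *
      -- δ` of the approximate median.
      have hsub : Metric.ball z r ∩ {x | (k : ℝ) + 1 < δ⁻¹ * |v x - n * δ|} ⊆
          (Metric.ball z r ∩ {x | n * δ + k * δ < v x}) ∪
          (Metric.ball z r ∩ {x | -((n - 1) * δ) + k * δ < -v x}) := by
        rintro x ⟨hxB, hx⟩
        rw [Set.mem_ofPred_eq, inv_mul_eq_div, lt_div_iff₀ hδ, lt_abs] at hx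
        rcases hx with hx | hx
        · refine Or.inl ⟨hxB, ?_⟩; simp only [Set.mem_ofPred_eq]; nlinarith
        · refine Or.inr ⟨hxB, ?_⟩; simp only [Set.mem_ofPred_eq]; nlinarith
      -- Each one-sided tail carries a factor `1 / 2` from the median, so their sum has constant
      -- one.
      have h2 : 2 * volume (Metric.ball z r ∩ {x | (k : ℝ) + 1 < δ⁻¹ * |v x - n * δ|}) ≤
          2 * (ENNReal.ofReal ((Real.exp (-α) / 2) ^ k) * volume (Metric.ball z r)) := by
        refine le_trans (mul_le_mul_right ((measure_mono hsub).trans (measure_union_le _ _)) _) ?_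
        rw [mul_add, two_mul (ENNReal.ofReal _ * _)]
        exact add_le_add (hup_k k) (hlow_k k)
      exact (ENNReal.mul_le_mul_iff_right (by simp) (by simp)).1 h2
  simpa only [Measure.restrict_apply_univ, mul_assoc] using key

theorem theorem2 (d : ℕ) (hd : 1 ≤ d) (α : ℝ) (hα : 0 < α) :
    ∃ M₀ : ℝ, 0 < M₀ ∧ ∃ C : ℝ, 0 < C ∧
      ∀ (δ : ℝ), 0 < δ →
      ∀ (z : EuclideanSpace ℝ (Fin d)) (r : ℝ), 0 < r →
      ∀ u : EuclideanSpace ℝ (Fin d) → ℝ,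
        AEMeasurable u (volume.restrict (Metric.ball z r)) →
        ENNReal.ofReal (δ ^ (-(d : ℝ))) * nonlocalEnergy δ (d : ℝ) u (Metric.ball z r)
          ≤ ENNReal.ofReal M₀ →
        IntegrableOn u (Metric.ball z r) volume ∧
        (⨍⁻ x in Metric.ball z r,
            ENNReal.ofReal
              (Real.exp (α * δ⁻¹ * |u x - ⨍ y in Metric.ball z r, u y ∂volume|)) ∂volume)
          ≤ ENNReal.ofReal C := by
  have hω := unitBallVolume_pos d
  set D := Real.exp α + 2 * Real.exp (2 * α) with hD
  have hD0 : 0 < D := by positivity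
  refine ⟨unitBallVolume d ^ 2 / 4 ^ (d + 1) * (Real.exp (-α) / 2), by positivity,
    Real.exp D * D, by positivity, fun δ hδ z r hr u hu hE => ?_⟩
  have : IsFiniteMeasure (volume.restrict (Metric.ball z r)) := ⟨by simp [measure_ball_lt_top]⟩
  have : NeZero (volume.restrict (Metric.ball z r)) :=
    ⟨fun h => (Metric.measure_ball_pos volume z hr).ne' (Measure.restrict_eq_zero.1 h)⟩
  have huv := hu.ae_eq_mk
  rw [nonlocalEnergy_congr_ae δ d measurableSet_ball huv] at hE
  obtain ⟨m, hm⟩ := exists_lintegral_exp_le_of_nonlocalEnergy_le hd hα hδ hr hu.measurable_mk hE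
  refine integrable_and_laverage_exp_le (m := m) _ hu (by positivity) hD0.le ?_
  rw [Measure.restrict_apply_univ]
  refine le_trans (le_of_eq (lintegral_congr_ae (huv.mono fun x hx => ?_))) hm
  simp only [hx]
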